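/- Let $s_1<s_2$ and let $Z:(s_1,s_2)\to\mathbb C$ be a real analytic curve parametrized by arc length, $|\partial_s Z|=1$, with real analytic tangential angle $\varphi$, i.e. $\partial_s Z=e^{i\varphi}$, and curvature $k=\partial_s\varphi$. Suppose that $Z$ is an elastica: the Euler–Bernoulli energy $\frac12\int k^2\,ds$ is stationary under every compactly supported smooth normal deformation $Z+t\,\varepsilon\,i\,\partial_sZ$ that preserves the length to first order in $t$. Then there are real constants $a,b$ with $$a k+\tfrac12k^3+\partial_s^2k=0,\qquad (\partial_sk)^2+\tfrac14k^4+ak^2+b=0 \quad\text{on }(s_1,s_2).$$ Let $a,b$ be any such constants, with $a^2\neq b$ and $b\neq0$. Let $\alpha\in\mathbb C$ be any fourth root of $(a^2-b)/16$, put $\hat a=-a/\alpha^2$, $\hat b=b/\alpha^4$ (so $\hat a^2-\hat b=16$), and let $C_1$ be the elliptic curve $$y^2=(x-e_1)(x-e_2)(x-e_3),\quad e_1=-\tfrac{\hat a}6,\quad e_2=\tfrac{\hat a}{12}+\tfrac{\sqrt{\hat b}}4,\quad e_3=\tfrac{\hat a}{12}-\tfrac{\sqrt{\hat b}}4 .$$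 (In particular, if $a^2-b=16$ and $\alpha=\pm i$, then $\hat a=a$ and $\hat b=b$.) Then $C_1$ has a period lattice $\Lambda$, that is, a lattice whose function $\wp$ satisfies $(\frac12\wp')^2=(\wp-e_1)(\wp-e_2)(\wp-e_3)$. If $\wp$ and $\zeta$ are the Weierstrass functions of such a lattice $\Lambda$, there are $\theta\in\mathbb R$ and $u_0,Z_0\in\mathbb C$ such that, after the change of the origin of the angle that replaces $\varphi$ by $\varphi+\theta$ and $Z$ by $e^{i\theta}Z$, for all $s\in(s_1,s_2)$ one has $\alpha s+u_0\notin\Lambda$ and $$\partial_sZ(s)=e^{i\varphi(s)}=i\bigl(\wp(\alpha s+u_0)-e_1\bigr),\qquad Z(s)=\frac i\alpha\bigl(-\zeta(\alpha s+u_0)-e_1\alpha s\bigr)+Z_0 .$$ -/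

import Mathlib

open scoped ContDiff

noncomputable section

namespace Elastica

/-! ### Plane curves, in `ℂ` -/

/-- The signed curvature of a regular plane curve in an arbitrary parametrization. -/
def curvature (γ : ℝ → ℂ) (s : ℝ) : ℝ :=
  ((starRingEnd ℂ) (deriv γ s) * deriv (deriv γ) s).im / ‖deriv γ s‖ ^ 3

/-- The length of the arc of `γ` over `[c, d]`. -/
def arcLength (γ : ℝ → ℂ) (c d : ℝ) : ℝ :=
  ∫ s in c..d, ‖deriv γ s‖

/-- The Euler-Bernoulli energy of the arc of `γ` over `[c, d]`: half the integral of the squared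
curvature with respect to arc length. -/
def bendingEnergy (γ : ℝ → ℂ) (c d : ℝ) : ℝ :=
  (1 / 2) * ∫ s in c..d, curvature γ s ^ 2 * ‖deriv γ s‖

/-- Isometric analytic immersions of the open interval `(s₁, s₂)` in the plane. -/
structure IsIsometricImmersion (Z : ℝ → ℂ) (s₁ s₂ : ℝ) : Prop where
  analytic : AnalyticOnNhd ℝ Z (Set.Ioo s₁ s₂)
  unit_speed : ∀ s ∈ Set.Ioo s₁ s₂, ‖deriv Z s‖ = 1

/-- `φ` is a (real analytic) tangential angle of `Z`: the tangent vector is `exp (i φ)`. -/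
structure IsTangentialAngle (φ : ℝ → ℝ) (Z : ℝ → ℂ) (s₁ s₂ : ℝ) : Prop where
  analytic : AnalyticOnNhd ℝ φ (Set.Ioo s₁ s₂)
  tangent : ∀ s ∈ Set.Ioo s₁ s₂, deriv Z s = Complex.exp (Complex.I * (φ s : ℂ))

/-- The deformation `Z + t ε n` of `Z` along its normal vector `n = i ∂ₛZ`. -/
def normalDeformation (Z : ℝ → ℂ) (ε : ℝ → ℝ) (t : ℝ) (s : ℝ) : ℂ :=
  Z s + (t : ℂ) * (ε s : ℂ) * (Complex.I * deriv Z s)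

/-- An elastica: an isometric analytic immersion at which the Euler-Bernoulli energy is stationary
under all normal deformations, supported away from the ends, that preserve the length to first
order. Minimizers at given length and given end data are stationary in this sense. -/
structure IsElastica (Z : ℝ → ℂ) (s₁ s₂ : ℝ) : Prop where
  immersion : IsIsometricImmersion Z s₁ s₂
  stationary : ∀ (c d : ℝ) (ε : ℝ → ℝ), s₁ < c → c < d → d < s₂ →
    ContDiff ℝ ∞ ε → tsupport ε ⊆ Set.Ioo c d →
    HasDerivAt (fun t : ℝ => arcLength (normalDeformation Z ε t) c d) 0 0 →
    HasDerivAt (fun t : ℝ => bendingEnergy (normalDeformation Z ε t) c d) 0 0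

/-- `a` and `b` are constants of the elastica equation for the curvature `k`:
`a k + k³ / 2 + k'' = 0`, with first integral `(k')² + k⁴ / 4 + a k² + b = 0`. -/
structure AreConstants (k : ℝ → ℝ) (s₁ s₂ a b : ℝ) : Prop where
  second_order : ∀ s ∈ Set.Ioo s₁ s₂,
    a * k s + (1 / 2) * k s ^ 3 + deriv (deriv k) s = 0
  first_order : ∀ s ∈ Set.Ioo s₁ s₂,
    deriv k s ^ 2 + (1 / 4) * k s ^ 4 + a * k s ^ 2 + b = 0

/-! ### The curve `C₁` and its Weierstrass functions -/

/-- The root `e₁ = - a / 6`. -/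
def e₁ (a : ℂ) : ℂ := -a / 6

/-- The cubic `(x - e₁) (x - e₂) (x - e₃)`, with `e₁ = - a / 6`, `e₂ = a / 12 + √b / 4` and
`e₃ = a / 12 - √b / 4`; the last two factors are multiplied out, so that no choice of a square root
of `b` is needed. The affine curve `C₁` is `y² = cubicC₁ a b x`. -/
def cubicC₁ (a b x : ℂ) : ℂ := (x - e₁ a) * ((x - a / 12) ^ 2 - b / 16)

/-- `L` generates the period lattice of `C₁`: its function `℘` parametrizes `C₁` by
`u ↦ (x, y) = (℘ u, ℘' u / 2)`. -/
def IsPeriodPairOfC₁ (L : PeriodPair) (a b : ℂ) : Prop :=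
  ∀ u : ℂ, u ∉ L.lattice →
    (L.derivWeierstrassP u / 2) ^ 2 = cubicC₁ a b (L.weierstrassP u)

/-- The Weierstrass function
`ζ u = 1 / u + ∑_{l ≠ 0} (1 / (u - l) + 1 / l + u / l²)` of the lattice of `L`. The term
`l = 0` of the sum below is `1 / u`, since `x / 0 = 0`. -/
def weierstrassZeta (L : PeriodPair) (u : ℂ) : ℂ :=
  ∑' l : L.lattice, (1 / (u - l) + 1 / (l : ℂ) + u / (l : ℂ) ^ 2)

end Elastica

end

/-! Under the normal variation ε, the length changes to first order by −∫ εk and the energy by ∫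
ε(k'' + k³/2). Constrained stationarity makes k'' + k³/2 a constant multiple −a of k; multiplying by
2k' and integrating gives b (`IsElastica.exists_areConstants`).

Put W = k²/2 + a − ik'. The two equations say that W' = ikW and |W|² = a² − b = |4α²|², so W = 4α²iE
with E = e^{i(φ+θ)} for some θ (`AreConstants.exists_rotation`). With the conjugate relation this
expresses k² and k' through E, and X = e₁ − iE satisfies the differential equations of s ↦ ℘(αs +
u₀). As ℘ is onto ℂ and even, some u₀ matches X and X' at one point. Uniqueness for the second-order
equation spreads the match along the interval; the first-order equation alone also has constant
solutions at the roots of the cubic. Integration with ζ' = −℘ gives Z.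

The lattice exists because C₁ is nonsingular and every nonsingular cubic 4x³ − c₂x − c₃ comes from a
lattice. This is the surjectivity of j, obtained from a zero of a weight 12 modular form. -/

/-! ### Modular forms and the existence of lattices with given invariants. -/

open UpperHalfPlane ModularForm MatrixGroups EisensteinSeries Filter Topology Manifold in
theorem ModularForm.exists_eq_zero_of_tendsto_ne_zero {k : ℤ} (hk : 0 < k)
    (f : ModularForm 𝒮ℒ k) {c : ℂ} (hc : c ≠ 0) (hf : Tendsto f atImInfty (𝓝 c)) :
    ∃ z : ℍ, f z = 0 := by
  by_contra! h0
  have hslash (γ : SL(2, ℤ)) : (fun z ↦ (f z)⁻¹) ∣[-k] γ = fun z ↦ (f z)⁻¹ := by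
    have hγ : (γ : GL (Fin 2) ℝ) ∈ 𝒮ℒ := ⟨γ, rfl⟩
    have h1 : (⇑f) ∣[k] γ = f := SlashInvariantForm.slash_action_eqn f _ hγ
    ext z
    have h2 := congrFun h1 z
    rw [SL_slash_apply] at h2 ⊢
    rw [← h2, mul_inv, ← zpow_neg]
  -- If f had no zero, 1/f would be a modular form of negative weight, bounded at the cusp because c
  -- ≠ 0; such forms vanish.
  let g : ModularForm 𝒮ℒ (-k) :=
    { toFun := fun z ↦ (f z)⁻¹
      slash_action_eq' := fun _ ⟨γ, hγ⟩ ↦ hγ ▸ hslash γ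
      holo' := by
        have h1 : MDiff (fun _ : ℍ ↦ (1 : ℂ)) := mdifferentiable_const
        have := h1.div f.holo' h0
        exact fun z ↦ (this z).congr_of_eventuallyEq (.of_forall fun z ↦ by simp [Pi.div_apply])
      bdd_at_cusps' := by
        intro c' hc'
        rw [Subgroup.IsArithmetic.isCusp_iff_isCusp_SL2Z] at hc'
        rw [OnePoint.isBoundedAt_iff_forall_SL2Z hc']
        intro γ _
        rw [hslash γ, IsBoundedAtImInfty, BoundedAtFilter]
        exact (hf.inv₀ hc).isBigO_one ℝ }
  have := congrFun (ModularFormClass.levelOne_neg_weight_eq_zero (by lia : -k < 0) g) I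
  exact inv_ne_zero (h0 I) this

open UpperHalfPlane ModularForm MatrixGroups EisensteinSeries Filter Topology Manifold in
theorem ModularForm.tendsto_E₄_atImInfty : Tendsto E₄ atImInfty (𝓝 1) := by
  have hanal := ModularFormClass.analyticAt_cuspFunction_zero E₄ one_pos one_mem_strictPeriods_SL
  have h0 : cuspFunction 1 E₄ 0 = 1 := by
    simpa [qExpansion_coeff] using E_qExpansion_coeff_zero (by norm_num : 3 ≤ 4) ⟨2, rfl⟩
  rw [← h0]
  exact (hanal.continuousAt.tendsto.comp (qParam_tendsto_atImInfty one_pos)).congr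
    (fun τ ↦ SlashInvariantFormClass.eq_cuspFunction E₄ τ one_mem_strictPeriods_SL one_ne_zero)

open UpperHalfPlane ModularForm MatrixGroups EisensteinSeries Filter Topology Manifold in
theorem ModularForm.exists_E₄_E₆_eq {A B : ℂ} (h : A ^ 3 ≠ B ^ 2) :
    ∃ (τ : ℍ) (w : ℂ), w ≠ 0 ∧ w ^ 4 * A = E₄ τ ∧ w ^ 6 * B = E₆ τ := by
  set D := A ^ 3 - B ^ 2 with hD
  have hD0 : D ≠ 0 := sub_ne_zero.mpr h
  let Δ' : ModularForm 𝒮ℒ 12 := CuspForm.discriminant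
  -- Since 1728 Δ = E₄³ − E₆², a zero of `f` is a point where E₄³ : E₆² = A³ : B², that is, where j
  -- has the required value. The value of `f` at the cusp is D ≠ 0, so a zero exists.
  let f : ModularForm 𝒮ℒ 12 := D • ModularForm.mcast (by decide) (E₄.pow 3) -
    (A ^ 3 * 1728) • Δ'
  have hf (z : ℍ) : f z = D * E₄ z ^ 3 - A ^ 3 * 1728 * discriminant z := by
    have h3 : (E₄.pow 3) z = E₄ z ^ 3 := by rw [coe_pow, Pi.pow_apply]
    simp [f, Δ', h3]
  have hΔ : Tendsto discriminant atImInfty (𝓝 0) := discriminant_isZeroAtImInfty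
  obtain ⟨τ, hτ⟩ := f.exists_eq_zero_of_tendsto_ne_zero (by norm_num) hD0 <| by
    have := ((tendsto_E₄_atImInfty.pow 3).const_mul D).sub (hΔ.const_mul (A ^ 3 * 1728))
    simp only [one_pow, mul_one, mul_zero, sub_zero] at this
    exact this.congr fun z ↦ (hf z).symm
  rw [hf] at hτ
  have hdisc := discriminant_eq_E₄_cube_sub_E₆_sq τ
  have hne := discriminant_ne_zero τ
  suffices H : ∀ x y d : ℂ, D * x ^ 3 - A ^ 3 * 1728 * d = 0 → d = (x ^ 3 - y ^ 2) / 1728 →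
      d ≠ 0 → ∃ w : ℂ, w ≠ 0 ∧ w ^ 4 * A = x ∧ w ^ 6 * B = y from ⟨τ, H _ _ _ hτ hdisc hne⟩
  clear! τ
  intro x y d hτ hdisc hne
  have h4 : D * x ^ 3 = 1728 * d * A ^ 3 := by linear_combination hτ
  have h6 : D * y ^ 2 = 1728 * d * B ^ 2 := by
    linear_combination hτ + D * 1728 * hdisc + 1728 * d * hD
  by_cases hA : A = 0
  -- When A = 0 the fourth power carries no information, and w is fixed by its sixth power instead.
  · have hx : x = 0 := by simpa [hA, hD0] using h4
    have hB : B ≠ 0 := by rintro rfl; simp [hA] at h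
    have hy : y ≠ 0 := by
      rintro hy
      simp [hx, hy] at hdisc
      exact hne hdisc
    obtain ⟨w, hw⟩ := IsAlgClosed.exists_pow_nat_eq (y / B) (by norm_num : 0 < 6)
    refine ⟨w, ?_, by simp [hA, hx], by rw [hw]; field_simp⟩
    rintro rfl
    exact div_ne_zero hy hB (by simpa using hw.symm)
  · have hx : x ≠ 0 := by
      rintro hx
      simp [hx, hA] at h4
      exact hne h4
    obtain ⟨w, hw⟩ := IsAlgClosed.exists_pow_nat_eq (x / A) (by norm_num : 0 < 4)
    have hw0 : w ≠ 0 := by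
      rintro rfl
      exact div_ne_zero hx hA (by simpa using hw.symm)
    have hw4 : w ^ 4 * A = x := by rw [hw]; field_simp
    have hsq : (w ^ 6 * B) ^ 2 = y ^ 2 := by
      apply mul_left_cancel₀ (mul_ne_zero hD0 (pow_ne_zero 3 hA))
      have : w ^ 12 * A ^ 3 = x ^ 3 := by rw [← hw4]; ring
      linear_combination D * B ^ 2 * this - A ^ 3 * h6 + B ^ 2 * h4
    rcases sq_eq_sq_iff_eq_or_eq_neg.mp hsq with h | h
    · exact ⟨w, hw0, hw4, h⟩
    -- Passing from w to iw keeps w⁴ and changes the sign of w⁶.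
    · refine ⟨Complex.I * w, by simp [hw0], ?_, ?_⟩
      · rw [mul_pow, Complex.I_pow_four, one_mul, hw4]
      · have : Complex.I ^ 6 = -1 := by
          rw [show 6 = 4 + 2 from rfl, pow_add, Complex.I_pow_four, Complex.I_sq, one_mul]
        rw [mul_pow, this]
        linear_combination -h

/-- The pair of periods `w τ`, `w` with quotient `τ` in the upper half-plane. -/
noncomputable def PeriodPair.ofUpperHalfPlane (τ : UpperHalfPlane) {w : ℂ} (hw : w ≠ 0) :
    PeriodPair where
  ω₁ := w * τ
  ω₂ := w
  indep := by
    rw [LinearIndependent.pair_iff]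
    intro s t h
    have h1 : (s * τ + t : ℂ) = 0 := by
      have : w * (s * τ + t) = 0 := by
        simp only [Complex.real_smul] at h
        linear_combination h
      exact (mul_eq_zero.mp this).resolve_left hw
    have hs : s = 0 := by
      have := congrArg Complex.im h1
      simpa [τ.im_ne_zero] using this
    subst hs
    exact ⟨rfl, by simpa using h1⟩

open UpperHalfPlane ModularForm EisensteinSeries in
theorem PeriodPair.G_ofUpperHalfPlane (τ : ℍ) {w : ℂ} (hw : w ≠ 0) {k : ℕ} (hk : 3 ≤ k) :
    (PeriodPair.ofUpperHalfPlane τ hw).G k = (w ^ k)⁻¹ * (2 * riemannZeta k * E hk τ) := by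
  have hE : E hk τ = (1 / 2 : ℂ) * eisensteinSeries (N := 1) 0 k τ := rfl
  have h2 : 2 * riemannZeta k * E hk τ = ∑' v : Fin 2 → ℤ, eisSummand k v τ := by
    rw [tsum_eisSummand_eq_riemannZeta_mul_eisensteinSeries hk, hE]
    ring
  rw [h2, PeriodPair.G, ← (PeriodPair.latticeEquivProd _).symm.toEquiv.tsum_eq,
    ← (finTwoArrowEquiv ℤ).tsum_eq, ← tsum_mul_left]
  refine tsum_congr fun v ↦ ?_
  have := (PeriodPair.ofUpperHalfPlane τ hw).latticeEquiv_symm_apply (v 0, v 1)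
  simp only [LinearEquiv.coe_toEquiv, finTwoArrowEquiv_apply]
  erw [this]
  simp only [eisSummand, zpow_neg, zpow_natCast, PeriodPair.ofUpperHalfPlane]
  rw [← mul_inv, ← mul_pow]
  ring_nf

theorem riemannZeta_six : riemannZeta 6 = Real.pi ^ 6 / 945 := by
  have h := riemannZeta_two_mul_nat (k := 3) (by norm_num)
  norm_num [Nat.factorial, show bernoulli 6 = 1 / 42 by decide +kernel] at h
  rw [h]
  ring

/-- Every cubic `4 x³ - c₂ x - c₃` with nonzero discriminant is the cubic of a lattice. -/
theorem PeriodPair.exists_g₂_eq_g₃_eq {c₂ c₃ : ℂ} (h : c₂ ^ 3 ≠ 27 * c₃ ^ 2) :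
    ∃ L : PeriodPair, L.g₂ = c₂ ∧ L.g₃ = c₃ := by
  have hpi : (Real.pi : ℂ) ≠ 0 := Complex.ofReal_ne_zero.mpr Real.pi_ne_zero
  -- The factors invert g₂ = (4π⁴/3) w⁻⁴ E₄ and g₃ = (8π⁶/27) w⁻⁶ E₆, which come from ζ(4) = π⁴/90
  -- and ζ(6) = π⁶/945.
  obtain ⟨τ, w, hw, h4, h6⟩ := ModularForm.exists_E₄_E₆_eq
    (A := 3 / (4 * Real.pi ^ 4) * c₂) (B := 27 / (8 * Real.pi ^ 6) * c₃) <| by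
      intro h0
      apply h
      field_simp at h0
      linear_combination h0 / 1728
  refine ⟨PeriodPair.ofUpperHalfPlane τ hw, ?_, ?_⟩
  · rw [PeriodPair.g₂, PeriodPair.G_ofUpperHalfPlane τ hw (by norm_num : 3 ≤ 4), ← h4]
    have := riemannZeta_four
    push_cast at this ⊢
    rw [this]
    field_simp
    norm_num
  · rw [PeriodPair.g₃, PeriodPair.G_ofUpperHalfPlane τ hw (by norm_num : 3 ≤ 6), ← h6]
    have := riemannZeta_six
    push_cast at this ⊢
    rw [this]
    field_simp
    norm_num

namespace Elastica

theorem four_mul_cubicC₁ (a b x : ℂ) :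
    4 * cubicC₁ a b x = 4 * x ^ 3 - (a ^ 2 / 12 + b / 4) * x - (a * b / 24 - a ^ 3 / 216) := by
  rw [cubicC₁, e₁]
  ring

theorem exists_isPeriodPairOfC₁ {a b : ℂ} (hb : b ≠ 0) (hab : a ^ 2 ≠ b) :
    ∃ L : PeriodPair, IsPeriodPairOfC₁ L a b := by
  obtain ⟨L, h2, h3⟩ := PeriodPair.exists_g₂_eq_g₃_eq
    (c₂ := a ^ 2 / 12 + b / 4) (c₃ := a * b / 24 - a ^ 3 / 216) <| by
      intro h
      -- The discriminant c₂³ − 27c₃² equals b(a² − b)²/64.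
      have : b * (a ^ 2 - b) ^ 2 = 0 := by linear_combination 64 * h
      simp [hb, sub_eq_zero, hab] at this
  refine ⟨L, fun u hu ↦ ?_⟩
  have := L.derivWeierstrassP_sq u hu
  rw [h2, h3, ← four_mul_cubicC₁] at this
  linear_combination this / 4

end Elastica

/-! ### Surjectivity of ℘ and its second-order equation. -/

namespace PeriodPair

open Filter Topology Bornology

variable (L : PeriodPair)

theorem tendsto_weierstrassP_cobounded {x : ℂ} (hx : x ∈ L.lattice) :
    Tendsto L.weierstrassP (𝓝[≠] x) (cobounded ℂ) := by
  rw [tendsto_cobounded_iff_meromorphicOrderAt_neg (L.meromorphic_weierstrassP x),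
    L.order_weierstrassP x hx]
  decide

theorem eventually_notMem_lattice (x : ℂ) : ∀ᶠ z in 𝓝[≠] x, z ∉ L.lattice := by
  filter_upwards [self_mem_nhdsWithin,
    mem_nhdsWithin_of_mem_nhds (L.compl_lattice_sdiff_singleton_mem_nhds x)] with z hz hz'
  exact fun h ↦ hz' ⟨h, hz⟩

theorem isPreconnected_compl_lattice : IsPreconnected (L.latticeᶜ : Set ℂ) :=
  (Set.Countable.isConnected_compl_of_one_lt_rank (by simp)
    (countable_of_Lindelof_of_discrete (X := L.lattice))).2

theorem hasDerivAt_weierstrassP {u : ℂ} (hu : u ∉ L.lattice) :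
    HasDerivAt L.weierstrassP (L.derivWeierstrassP u) u := by
  have := (L.analyticOnNhd_weierstrassP u hu).differentiableAt.hasDerivAt
  rwa [L.deriv_weierstrassP] at this

/-- The function `℘` takes every value off the lattice. -/
theorem exists_weierstrassP_eq (c : ℂ) : ∃ u ∉ L.lattice, L.weierstrassP u = c := by
  by_contra! h
  classical
  -- If ℘ omitted c, then 1/(℘ − c), set to 0 at the poles of ℘, would be entire and periodic, hence
  -- bounded and constant by Liouville. It is 0 at the origin and nonzero at ω₁/2.
  let f : ℂ → ℂ := fun z ↦ if z ∈ L.lattice then 0 else (L.weierstrassP z - c)⁻¹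
  have hf0 (z : ℂ) (hz : z ∉ L.lattice) : f z = (L.weierstrassP z - c)⁻¹ := if_neg hz
  have hd (z : ℂ) (hz : z ∉ L.lattice) : DifferentiableAt ℂ f z := by
    have h1 : DifferentiableAt ℂ (fun w ↦ (L.weierstrassP w - c)⁻¹) z :=
      ((L.hasDerivAt_weierstrassP hz).differentiableAt.sub_const c).inv (sub_ne_zero.mpr (h z hz))
    refine h1.congr_of_eventuallyEq ?_
    filter_upwards [L.isClosed_lattice.isOpen_compl.mem_nhds hz] with w hw using hf0 w hw
  have hdiff : Differentiable ℂ f := by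
    intro z
    by_cases hz : z ∈ L.lattice
    · refine (Complex.analyticAt_of_differentiable_on_punctured_nhds_of_continuousAt
        ((L.eventually_notMem_lattice z).mono hd) ?_).differentiableAt
      rw [continuousAt_iff_punctured_nhds, show f z = 0 from if_pos hz]
      have h1 : Tendsto (fun w ↦ L.weierstrassP w - c) (𝓝[≠] z) (cobounded ℂ) := by
        simpa [sub_eq_add_neg, Function.comp_def] using
          (tendsto_add_const_cobounded (-c)).comp (L.tendsto_weierstrassP_cobounded hz)
      refine (tendsto_inv₀_cobounded.comp h1).congr' ?_
      filter_upwards [L.eventually_notMem_lattice z] with w hw using (hf0 w hw).symm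
    · exact hd z hz
  have hb := (IsZLattice.isCompact_range_of_periodic L.lattice f hdiff.continuous fun z w hw ↦ by
    have : z + w ∈ L.lattice ↔ z ∈ L.lattice := L.lattice.add_mem_iff_left hw
    simp only [f, this]
    lift w to L.lattice using hw
    simp).isBounded
  have := hdiff.apply_eq_apply_of_bounded hb (L.ω₁ / 2) 0
  rw [hf0 _ L.ω₁_div_two_notMem_lattice, show f 0 = 0 from if_pos (zero_mem _), inv_eq_zero,
    sub_eq_zero] at this
  exact h _ L.ω₁_div_two_notMem_lattice this

/-- The second order differential equation of `℘`, from the first order one. -/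
theorem hasDerivAt_derivWeierstrassP {c₂ c₃ : ℂ}
    (h : ∀ u ∉ L.lattice,
      L.derivWeierstrassP u ^ 2 = 4 * L.weierstrassP u ^ 3 - c₂ * L.weierstrassP u - c₃)
    {u : ℂ} (hu : u ∉ L.lattice) :
    HasDerivAt L.derivWeierstrassP (6 * L.weierstrassP u ^ 2 - c₂ / 2) u := by
  have hopen : IsOpen (L.latticeᶜ : Set ℂ) := L.isClosed_lattice.isOpen_compl
  have hd (z : ℂ) (hz : z ∉ L.lattice) : DifferentiableAt ℂ L.derivWeierstrassP z :=
    (L.analyticOnNhd_derivWeierstrassP z hz).differentiableAt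
  have hh : AnalyticOnNhd ℂ (fun z ↦ deriv L.derivWeierstrassP z -
      (6 * L.weierstrassP z ^ 2 - c₂ / 2)) L.latticeᶜ := fun z hz ↦ by
    have := (L.analyticOnNhd_derivWeierstrassP z hz).deriv
    have := L.analyticOnNhd_weierstrassP z hz
    fun_prop
  have hmul : ∀ z ∈ (L.latticeᶜ : Set ℂ), L.derivWeierstrassP z *
      (deriv L.derivWeierstrassP z - (6 * L.weierstrassP z ^ 2 - c₂ / 2)) = 0 := by
    intro z hz
    have h1 := (hd z hz).hasDerivAt.pow 2
    have hP := L.hasDerivAt_weierstrassP hz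
    have h2 := (((hP.pow 3).const_mul 4).sub (hP.const_mul c₂)).sub_const c₃
    have h3 := h1.unique (h2.congr_of_eventuallyEq <| by
      filter_upwards [hopen.mem_nhds hz] with w hw using h w hw)
    norm_num at h3
    linear_combination h3 / 2
  -- The factor ℘' can be cancelled by the identity theorem on the connected complement of the
  -- lattice: ℘' is not identically 0, because ℘ takes both values 0 and 1.
  rcases L.analyticOnNhd_derivWeierstrassP.eq_zero_or_eq_zero_of_mul_eq_zero hh
    hmul L.isPreconnected_compl_lattice with h0 | h0
  · exfalso
    obtain ⟨x, hx, hx1⟩ := L.exists_weierstrassP_eq 0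
    obtain ⟨y, hy, hy1⟩ := L.exists_weierstrassP_eq 1
    have := hopen.is_const_of_deriv_eq_zero L.isPreconnected_compl_lattice
      L.differentiableOn_weierstrassP (fun z hz ↦ by rw [L.deriv_weierstrassP]; exact h0 z hz) hx hy
    simp [hx1, hy1] at this
  · have := h0 u hu
    rw [← sub_eq_zero.mp this]
    exact (hd u hu).hasDerivAt

end PeriodPair

/-! ### The Weierstrass ζ function. -/

namespace Elastica

open Filter Topology

/-- The summand collapses to u²/((u − l)l²). This cubic decay is summable over a lattice of rank 2.
-/
theorem zeta_summand_bound {r : ℝ} (hr : 0 < r) {u l : ℂ} (hu : ‖u‖ < r) (hl : 2 * r ≤ ‖l‖) :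
    ‖1 / (u - l) + 1 / l + u / l ^ 2‖ ≤ 2 * r ^ 2 * ‖l‖ ^ (-3 : ℝ) := by
  have hl0 : 0 < ‖l‖ := by linarith
  have hl1 : l ≠ 0 := norm_pos_iff.mp hl0
  have hdist : ‖l‖ / 2 ≤ ‖u - l‖ := by
    have := norm_sub_norm_le l u
    rw [norm_sub_rev] at this
    linarith
  have hul : u - l ≠ 0 := norm_pos_iff.mp (by linarith)
  have h1 : 1 / (u - l) + 1 / l + u / l ^ 2 = u ^ 2 / ((u - l) * l ^ 2) := by
    field_simp
    ring
  have h2 : ‖l‖ ^ (-3 : ℝ) = (‖l‖ ^ 3)⁻¹ := by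
    rw [Real.rpow_neg hl0.le]
    norm_cast
  rw [h1, h2, norm_div, norm_mul, norm_pow, norm_pow]
  calc ‖u‖ ^ 2 / (‖u - l‖ * ‖l‖ ^ 2) ≤ r ^ 2 / (‖l‖ / 2 * ‖l‖ ^ 2) := by gcongr
    _ = 2 * r ^ 2 * (‖l‖ ^ 3)⁻¹ := by field_simp

theorem hasSum_weierstrassZeta (L : PeriodPair) (u : ℂ) :
    HasSum (fun l : L.lattice ↦ 1 / (u - l) + 1 / (l : ℂ) + u / (l : ℂ) ^ 2)
      (weierstrassZeta L u) := by
  refine (L.hasSumLocallyUniformly_aux (u := fun r l ↦ 2 * r ^ 2 * ‖l‖ ^ (-3 : ℝ))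
    (fun (l : L.lattice) (u : ℂ) ↦ 1 / (u - l) + 1 / (l : ℂ) + u / (l : ℂ) ^ 2)
    (fun _ _ ↦ (ZLattice.summable_norm_rpow _ _ (by simp; norm_num)).mul_left _) fun r hr ↦
    eventually_atTop.mpr ⟨2 * r, ?_⟩).hasSum
  rintro _ h s hs l rfl
  exact zeta_summand_bound hr hs h

/-- Termwise differentiation: locally uniform convergence is needed only for the differentiated
series, which is that of ℘, together with pointwise convergence of the series of ζ. -/
theorem hasDerivAt_weierstrassZeta (L : PeriodPair) {u : ℂ} (hu : u ∉ L.lattice) :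
    HasDerivAt (weierstrassZeta L) (-L.weierstrassP u) u := by
  have hlim := L.hasSumLocallyUniformly_weierstrassP.tendstoLocallyUniformlyOn (s := L.latticeᶜ)
  have := hasDerivAt_of_tendstoLocallyUniformlyOn (g := fun z ↦ -weierstrassZeta L z)
    (f := fun (t : Finset L.lattice) (z : ℂ) ↦
      ∑ l ∈ t, -(1 / (z - l) + 1 / (l : ℂ) + z / (l : ℂ) ^ 2))
    L.isClosed_lattice.isOpen_compl hlim (.of_forall fun t z hz ↦ ?_)
    (fun z _ ↦ (hasSum_weierstrassZeta L z).neg) hu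
  · simpa [Pi.neg_def] using this.neg
  · refine HasDerivAt.fun_sum fun l _ ↦ ?_
    have hzl : z - l ≠ 0 := fun h ↦ hz (by rw [sub_eq_zero.mp h]; exact l.2)
    have h1 : HasDerivAt (fun w : ℂ ↦ w - l) 1 z := (hasDerivAt_id z).sub_const _
    have h2 := (((h1.inv hzl).add_const (1 / (l : ℂ))).add
      ((hasDerivAt_id z).div_const ((l : ℂ) ^ 2))).neg
    simp only [one_div] at h2 ⊢
    refine h2.congr_deriv ?_
    field_simp
    ring

theorem IsPeriodPairOfC₁.derivWeierstrassP_sq {L : PeriodPair} {a b : ℂ}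
    (h : IsPeriodPairOfC₁ L a b) {u : ℂ} (hu : u ∉ L.lattice) :
    L.derivWeierstrassP u ^ 2 = 4 * L.weierstrassP u ^ 3 - (a ^ 2 / 12 + b / 4) * L.weierstrassP u
      - (a * b / 24 - a ^ 3 / 216) := by
  rw [← four_mul_cubicC₁, ← h u hu]
  ring

end Elastica

/-! ### From the differential equation to ℘(αs + u₀). -/

section

open Filter Topology Bornology Set

/-- Bounded solutions on an interval of the differential equation of `s ↦ ℘ (α s + u₀)` are of
this form. -/
theorem PeriodPair.exists_eq_weierstrassP_of_ode (L : PeriodPair) {α c₂ c₃ : ℂ} (hα : α ≠ 0)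
    (hL : ∀ u ∉ L.lattice,
      L.derivWeierstrassP u ^ 2 = 4 * L.weierstrassP u ^ 3 - c₂ * L.weierstrassP u - c₃)
    {s₁ s₂ : ℝ} (hs : s₁ < s₂) {X V : ℝ → ℂ}
    (hX : ∀ s ∈ Ioo s₁ s₂, HasDerivAt X (V s) s)
    (hV : ∀ s ∈ Ioo s₁ s₂, HasDerivAt V (α ^ 2 * (6 * X s ^ 2 - c₂ / 2)) s)
    (hXV : ∀ s ∈ Ioo s₁ s₂, V s ^ 2 = α ^ 2 * (4 * X s ^ 3 - c₂ * X s - c₃)) :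
    ∃ u₀ : ℂ, ∀ s ∈ Ioo s₁ s₂, α * s + u₀ ∉ L.lattice ∧ X s = L.weierstrassP (α * s + u₀) := by
  obtain ⟨m, hm⟩ := nonempty_Ioo.mpr hs
  obtain ⟨u, hu, huX, huV⟩ :
      ∃ u ∉ L.lattice, L.weierstrassP u = X m ∧ α * L.derivWeierstrassP u = V m := by
    obtain ⟨u, hu, huX⟩ := L.exists_weierstrassP_eq (X m)
    have hsq : (α * L.derivWeierstrassP u) ^ 2 = V m ^ 2 := by
      rw [hXV m hm, mul_pow, hL u hu, huX]
    -- The first-order equation fixes ℘'(u) up to sign; ℘ is even and ℘' odd, so −u corrects the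
    -- sign.
    rcases sq_eq_sq_iff_eq_or_eq_neg.mp hsq with h | h
    · exact ⟨u, hu, huX, h⟩
    · exact ⟨-u, fun hn ↦ hu (by simpa using neg_mem hn), by simpa using huX, by simp [h]⟩
  let u₀ := u - α * m
  -- Continuity argument: the set where values and derivatives agree is open by local uniqueness for
  -- the first-order system in (X, V), and relatively closed in the interval.
  let S : Set ℝ := {s | s ∈ Ioo s₁ s₂ ∧ α * s + u₀ ∉ L.lattice ∧
    X s = L.weierstrassP (α * s + u₀) ∧ V s = α * L.derivWeierstrassP (α * s + u₀)}
  have hlin (s : ℝ) : HasDerivAt (fun z : ℂ ↦ α * z + u₀) α (s : ℂ) := by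
    simpa using ((hasDerivAt_id (s : ℂ)).const_mul α).add_const u₀
  have hlinc : Continuous fun s : ℝ ↦ α * (s : ℂ) + u₀ := by fun_prop
  have hP (s : ℝ) (h : α * s + u₀ ∉ L.lattice) :
      HasDerivAt (fun s : ℝ ↦ L.weierstrassP (α * s + u₀))
        (α * L.derivWeierstrassP (α * s + u₀)) s := by
    have := ((L.hasDerivAt_weierstrassP h).comp (s : ℂ) (hlin s)).comp_ofReal
    rwa [mul_comm] at this
  have hP' (s : ℝ) (h : α * s + u₀ ∉ L.lattice) :
      HasDerivAt (fun s : ℝ ↦ α * L.derivWeierstrassP (α * s + u₀))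
        (α ^ 2 * (6 * L.weierstrassP (α * s + u₀) ^ 2 - c₂ / 2)) s := by
    have := ((L.hasDerivAt_derivWeierstrassP hL h).comp (s : ℂ) (hlin s)).comp_ofReal.const_mul α
    exact this.congr_deriv (by ring)
  have hopenL (s : ℝ) (h : α * s + u₀ ∉ L.lattice) : ∀ᶠ t : ℝ in 𝓝 s, α * t + u₀ ∉ L.lattice :=
    hlinc.continuousAt.eventually (L.isClosed_lattice.isOpen_compl.mem_nhds h)
  have hSopen : IsOpen S := by
    rw [isOpen_iff_mem_nhds]
    rintro s ⟨hs, hsL, hsX, hsV⟩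
    let v : ℂ × ℂ → ℂ × ℂ := fun p ↦ (p.2, α ^ 2 * (6 * p.1 ^ 2 - c₂ / 2))
    have hv : ContDiff ℝ 1 v := by fun_prop
    obtain ⟨K, T, hT, hK⟩ := (hv.contDiffAt (x := (X s, V s))).exists_lipschitzOnWith
    have hIoo := Ioo_mem_nhds hs.1 hs.2
    have hf (t : ℝ) (ht : t ∈ Ioo s₁ s₂) :
        HasDerivAt (fun t ↦ (X t, V t)) (v (X t, V t)) t := (hX t ht).prodMk (hV t ht)
    let g : ℝ → ℂ × ℂ := fun t ↦
      (L.weierstrassP (α * t + u₀), α * L.derivWeierstrassP (α * t + u₀))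
    have hg (t : ℝ) (ht : α * t + u₀ ∉ L.lattice) : HasDerivAt g (v (g t)) t :=
      (hP t ht).prodMk (hP' t ht)
    have heq : (fun t ↦ (X t, V t)) =ᶠ[𝓝 s] g := by
      have hfg : (X s, V s) = g s := by simp only [g, hsX, hsV]
      refine ODE_solution_unique_of_eventually (v := fun _ ↦ v) (s := fun _ ↦ T) (K := K)
        (.of_forall fun _ ↦ hK) ?_ ?_ hfg
      · filter_upwards [hIoo, (hf s hs).continuousAt.eventually hT] with t ht ht'
          using ⟨hf t ht, ht'⟩
      · filter_upwards [hopenL s hsL, (hg s hsL).continuousAt.eventually (hfg ▸ hT)] with t ht ht'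
          using ⟨hg t ht, ht'⟩
    filter_upwards [hIoo, hopenL s hsL, heq] with t h1 h2 h3
    exact ⟨h1, h2, congrArg Prod.fst h3, congrArg Prod.snd h3⟩
  have hmS : m ∈ S := by
    refine ⟨hm, ?_⟩
    simp only [u₀, add_sub_cancel]
    exact ⟨hu, huX.symm, huV.symm⟩
  have hsub := isPreconnected_Ioo.subset_of_closure_inter_subset hSopen ⟨m, hm, hmS⟩ ?_
  · exact ⟨u₀, fun s hs ↦ ⟨(hsub hs).2.1, (hsub hs).2.2.1⟩⟩
  rintro t ⟨htS, ht⟩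
  rw [mem_closure_iff_frequently] at htS
  -- A limit point of `S` cannot land on a pole: |℘| would tend to infinity there, while X is
  -- continuous at t.
  have htL : α * t + u₀ ∉ L.lattice := by
    intro htL
    have h1 : Tendsto (fun s : ℝ ↦ α * (s : ℂ) + u₀) (𝓝[≠] t) (𝓝[≠] (α * t + u₀)) := by
      refine tendsto_nhdsWithin_of_tendsto_nhds_of_eventually_within _
        (hlinc.continuousAt.tendsto.mono_left nhdsWithin_le_nhds) ?_
      filter_upwards [self_mem_nhdsWithin] with s hs h
      exact hs (by simpa [hα] using h)
    have h2 := tendsto_norm_cobounded_atTop.comp ((L.tendsto_weierstrassP_cobounded htL).comp h1)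
    have h3 := eventually_nhdsWithin_iff.mp (h2.eventually_gt_atTop (‖X t‖ + 1))
    have h4 := (hX t ht).continuousAt.norm.eventually_lt_const (lt_add_one ‖X t‖)
    refine htS ?_
    filter_upwards [h3, h4] with s h5 h6 hsS
    by_cases hst : s = t
    · subst hst
      exact hsS.2.1 htL
    · have := h5 hst
      simp only [Function.comp_apply, ← hsS.2.2.1] at this
      linarith
  refine ⟨ht, htL, ?_, ?_⟩
  · by_contra hne
    exact htS (((hX t ht).continuousAt.sub (hP t htL).continuousAt).eventually_ne
      (sub_ne_zero.mpr hne) |>.mono fun s hs hsS ↦ hs (sub_eq_zero.mpr hsS.2.2.1))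
  · by_contra hne
    exact htS (((hV t ht).continuousAt.sub (hP' t htL).continuousAt).eventually_ne
      (sub_ne_zero.mpr hne) |>.mono fun s hs hsS ↦ hs (sub_eq_zero.mpr hsS.2.2.2))

/-! ### Integration of the elastica equation. -/

namespace Elastica

/-- The tangent of an elastica, up to a rotation, is an affine function of
`e^{iψ} = W / √(a² - b)` with `W = k² / 2 + a - i k'`. -/
theorem AreConstants.exists_rotation {φ : ℝ → ℝ} {s₁ s₂ a b : ℝ} (hs : s₁ < s₂)
    (hφ : AnalyticOnNhd ℝ φ (Ioo s₁ s₂)) (hab : AreConstants (deriv φ) s₁ s₂ a b)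
    (hne : a ^ 2 ≠ b) {α : ℂ} (hα : α ^ 4 = ((a : ℂ) ^ 2 - b) / 16) :
    ∃ θ : ℝ, ∀ s ∈ Ioo s₁ s₂,
      ((1 / 2 * deriv φ s ^ 2 + a : ℝ) : ℂ) - Complex.I * deriv (deriv φ) s =
        4 * α ^ 2 * Complex.I * Complex.exp (Complex.I * (φ s + θ)) := by
  set k := deriv φ
  let W : ℝ → ℂ := fun s ↦ ((1 / 2 * k s ^ 2 + a : ℝ) : ℂ) - Complex.I * deriv k s
  have hk (s : ℝ) (h : s ∈ Ioo s₁ s₂) : HasDerivAt k (deriv k s) s :=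
    (hφ s h).deriv.differentiableAt.hasDerivAt
  have hk' (s : ℝ) (h : s ∈ Ioo s₁ s₂) : HasDerivAt (deriv k) (deriv (deriv k) s) s :=
    (hφ s h).deriv.deriv.differentiableAt.hasDerivAt
  have hφ' (s : ℝ) (h : s ∈ Ioo s₁ s₂) : HasDerivAt φ (k s) s :=
    (hφ s h).differentiableAt.hasDerivAt
  have hα0 : α ≠ 0 := by
    rintro rfl
    have : (a : ℂ) ^ 2 - b = 0 := by linear_combination -16 * hα
    exact hne (by exact_mod_cast sub_eq_zero.mp this)
  have hα4 : 4 * α ^ 2 ≠ 0 := by simp [hα0]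
  -- The second-order equation gives W' = ikW, so W e^{−iφ} is constant.
  let C : ℝ → ℂ := fun s ↦ W s * Complex.exp (-(Complex.I * φ s))
  have hC (s : ℝ) (h : s ∈ Ioo s₁ s₂) : HasDerivAt C 0 s := by
    have h1 : HasDerivAt (fun s ↦ ((1 / 2 * k s ^ 2 + a : ℝ) : ℂ))
        ((1 / 2 * (2 * k s * deriv k s) : ℝ) : ℂ) s :=
      HasDerivAt.ofReal_comp (by simpa [-one_div] using (((hk s h).pow 2).const_mul (1 / 2)).add_const a)
    have h2 := h1.sub ((hk' s h).ofReal_comp.const_mul Complex.I)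
    have h3 := (((hφ' s h).ofReal_comp.const_mul Complex.I).neg).cexp
    refine (h2.mul h3).congr_deriv ?_
    have h4 : ((deriv (deriv k) s : ℝ) : ℂ) = -(a * k s + 1 / 2 * k s ^ 3) := by
      have := hab.second_order s h
      rw [← Complex.ofReal_ofNat, ← Complex.ofReal_one]
      norm_cast
      linarith
    rw [h4]
    push_cast
    simp only [Pi.sub_apply, Pi.neg_apply]
    linear_combination (k s * ((deriv k s : ℝ) : ℂ) * Complex.exp (-(Complex.I * φ s))) *
      Complex.I_sq
  obtain ⟨m, hm⟩ := nonempty_Ioo.mpr hs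
  let D : ℂ := C m / (4 * α ^ 2 * Complex.I)
  -- The first integral reads |W|² = a² − b, and (4α²)² = a² − b as well. Hence D is unimodular and
  -- its argument serves as θ.
  have hnorm : ‖D‖ = 1 := by
    have h1 : ‖W m‖ ^ 2 = a ^ 2 - b := by
      rw [← Complex.normSq_eq_norm_sq, Complex.normSq_apply]
      simp only [W, Complex.sub_re, Complex.sub_im, Complex.ofReal_re, Complex.ofReal_im,
        Complex.mul_re, Complex.mul_im, Complex.I_re, Complex.I_im]
      linear_combination hab.first_order m hm
    have h2 : ‖4 * α ^ 2‖ ^ 2 = a ^ 2 - b := by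
      have h3 : (4 * α ^ 2) ^ 2 = ((a ^ 2 - b : ℝ) : ℂ) := by
        push_cast
        linear_combination 16 * hα
      rw [← norm_pow, h3, Complex.norm_real, Real.norm_of_nonneg (h1 ▸ sq_nonneg _)]
    have h4 : ‖W m‖ = ‖4 * α ^ 2‖ :=
      (sq_eq_sq₀ (norm_nonneg _) (norm_nonneg _)).mp (h1.trans h2.symm)
    have h5 : ‖Complex.exp (-(Complex.I * φ m))‖ = 1 := by
      rw [Complex.norm_exp]
      simp
    simp only [D, C]
    rw [norm_div, norm_mul, norm_mul _ Complex.I, h5, h4, Complex.norm_I, mul_one,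
      div_self (norm_ne_zero_iff.mpr hα4)]
  refine ⟨D.arg, fun s h ↦ ?_⟩
  have hD : Complex.exp (Complex.I * D.arg) = D := by
    have := Complex.norm_mul_exp_arg_mul_I D
    rwa [hnorm, Complex.ofReal_one, one_mul, mul_comm] at this
  have hCs : C s = C m := isOpen_Ioo.is_const_of_deriv_eq_zero isPreconnected_Ioo
    (fun t ht ↦ (hC t ht).differentiableAt.differentiableWithinAt)
    (fun t ht ↦ (hC t ht).deriv) h hm
  rw [mul_add, Complex.exp_add, hD]
  simp only [D, ← hCs, C]
  have : Complex.exp (-(Complex.I * φ s)) * Complex.exp (Complex.I * φ s) = 1 := by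
    rw [← Complex.exp_add]
    simp
  change W s = _
  field_simp
  linear_combination (-W s) * this

theorem AreConstants.exists_weierstrass {φ : ℝ → ℝ} {Z : ℝ → ℂ} {s₁ s₂ a b : ℝ} (hs : s₁ < s₂)
    (hZ : DifferentiableOn ℝ Z (Ioo s₁ s₂)) (hφ : IsTangentialAngle φ Z s₁ s₂)
    (hab : AreConstants (deriv φ) s₁ s₂ a b)
    (hne : a ^ 2 ≠ b) {α : ℂ} (hα : α ^ 4 = ((a : ℂ) ^ 2 - b) / 16) {L : PeriodPair}
    (hL : IsPeriodPairOfC₁ L (-a / α ^ 2) (b / α ^ 4)) :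
    ∃ (θ : ℝ) (u₀ Z₀ : ℂ), ∀ s ∈ Ioo s₁ s₂,
      α * s + u₀ ∉ L.lattice ∧
      Complex.exp (Complex.I * θ) * deriv Z s = Complex.exp (Complex.I * (φ s + θ)) ∧
      Complex.exp (Complex.I * (φ s + θ)) =
        Complex.I * (L.weierstrassP (α * s + u₀) - e₁ (-a / α ^ 2)) ∧
      Complex.exp (Complex.I * θ) * Z s =
        Complex.I / α * (-weierstrassZeta L (α * s + u₀) - e₁ (-a / α ^ 2) * α * s) + Z₀ := by
  obtain ⟨θ, hθ⟩ := hab.exists_rotation hs hφ.analytic hne hα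
  have hα0 : α ≠ 0 := by
    rintro rfl
    have : (a : ℂ) ^ 2 - b = 0 := by linear_combination -16 * hα
    exact hne (by exact_mod_cast sub_eq_zero.mp this)
  set A : ℂ := -a / α ^ 2 with hA
  set B : ℂ := b / α ^ 4 with hB
  have ha : (a : ℂ) = -A * α ^ 2 := by rw [hA]; field_simp
  have hAB : A ^ 2 - B = 16 := by
    rw [hA, hB]
    field_simp
    linear_combination -16 * hα
  set k := deriv φ
  let E : ℝ → ℂ := fun s ↦ Complex.exp (Complex.I * (φ s + θ))
  have hEd (s : ℝ) (h : s ∈ Ioo s₁ s₂) : HasDerivAt E (Complex.I * k s * E s) s := by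
    have h1 : HasDerivAt φ (k s) s := (hφ.analytic s h).differentiableAt.hasDerivAt
    have h2 := ((h1.ofReal_comp.add_const (θ : ℂ)).const_mul Complex.I).cexp
    exact h2.congr_deriv (by simp only [E]; ring)
  have hk (s : ℝ) (h : s ∈ Ioo s₁ s₂) : HasDerivAt k (deriv k s) s :=
    (hφ.analytic s h).deriv.differentiableAt.hasDerivAt
  have hW (s : ℝ) (h : s ∈ Ioo s₁ s₂) :
      1 / 2 * (k s : ℂ) ^ 2 + a - Complex.I * deriv k s = 4 * α ^ 2 * Complex.I * E s := by
    have := hθ s h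
    push_cast at this
    exact this
  -- The left factor is the conjugate of W; the relation follows from |W|² = 16α⁴ and W = 4α²iE.
  have hW' (s : ℝ) (h : s ∈ Ioo s₁ s₂) :
      (1 / 2 * (k s : ℂ) ^ 2 + a + Complex.I * deriv k s) * E s = -4 * Complex.I * α ^ 2 := by
    have h1 : ((1 / 2 * (k s : ℂ) ^ 2 + a) ^ 2 + ((deriv k s : ℝ) : ℂ) ^ 2) = 16 * α ^ 4 := by
      have := congrArg (fun x : ℝ ↦ (x : ℂ)) (hab.first_order s h)
      push_cast at this
      linear_combination this - 16 * hα
    have h2 : 4 * α ^ 2 * Complex.I ≠ 0 := by simp [hα0]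
    apply mul_left_cancel₀ h2
    linear_combination (-(1 / 2 * (k s : ℂ) ^ 2 + a + Complex.I * ((deriv k s : ℝ) : ℂ))) * hW s h + h1
      + (16 * α ^ 4 - ((deriv k s : ℝ) : ℂ) ^ 2) * Complex.I_sq
  -- Solving E = i(℘ − e₁) for ℘. Then X' = kE, and eliminating k² and k' by `hW` and `hW'` leaves
  -- polynomials in E, hence in X.
  let X : ℝ → ℂ := fun s ↦ e₁ A - Complex.I * E s
  have hX (s : ℝ) (h : s ∈ Ioo s₁ s₂) : HasDerivAt X (k s * E s) s := by
    refine (((hEd s h).const_mul Complex.I).const_sub (e₁ A)).congr_deriv ?_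
    linear_combination (-(k s * E s)) * Complex.I_sq
  have hV (s : ℝ) (h : s ∈ Ioo s₁ s₂) : HasDerivAt (fun s ↦ k s * E s)
      (α ^ 2 * (6 * X s ^ 2 - (A ^ 2 / 12 + B / 4) / 2)) s := by
    refine ((hk s h).ofReal_comp.mul (hEd s h)).congr_deriv ?_
    have h1 := hW s h
    have h2 := hW' s h
    rw [ha] at h1 h2
    simp only [X, e₁]
    linear_combination Complex.I * (E s * h1 + h2) - Complex.I / 2 * (h2 - E s * h1) +
      (((deriv k s : ℝ) : ℂ) * E s - 2 * α ^ 2) * Complex.I_sq - α ^ 2 / 8 * hAB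
  have hXV (s : ℝ) (h : s ∈ Ioo s₁ s₂) : (k s * E s) ^ 2 = α ^ 2 * (4 * X s ^ 3 -
      (A ^ 2 / 12 + B / 4) * X s - (A * B / 24 - A ^ 3 / 216)) := by
    have h1 := hW s h
    have h2 := hW' s h
    rw [ha] at h1 h2
    simp only [X, e₁]
    linear_combination E s * (E s * h1 + h2) + (2 * α ^ 2 * A * E s ^ 2 +
      4 * α ^ 2 * Complex.I * E s ^ 3) * Complex.I_sq + α ^ 2 * Complex.I * E s / 4 * hAB
  obtain ⟨u₀, hu₀⟩ := L.exists_eq_weierstrassP_of_ode hα0 (fun u hu ↦ hL.derivWeierstrassP_sq hu)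
    hs hX hV hXV
  have hEX (s : ℝ) (h : s ∈ Ioo s₁ s₂) :
      E s = Complex.I * (L.weierstrassP (α * s + u₀) - e₁ A) := by
    rw [← (hu₀ s h).2]
    linear_combination E s * Complex.I_sq
  have hZE (s : ℝ) (h : s ∈ Ioo s₁ s₂) : Complex.exp (Complex.I * θ) * deriv Z s = E s := by
    rw [hφ.tangent s h, ← Complex.exp_add]
    simp only [E]
    ring_nf
  let F : ℝ → ℂ := fun s ↦ Complex.exp (Complex.I * θ) * Z s -
    Complex.I / α * (-weierstrassZeta L (α * s + u₀) - e₁ A * α * s)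
  have hF (s : ℝ) (h : s ∈ Ioo s₁ s₂) : HasDerivAt F 0 s := by
    have h1 := ((hZ.differentiableAt (isOpen_Ioo.mem_nhds h)).hasDerivAt).const_mul
      (Complex.exp (Complex.I * θ))
    have hlin : HasDerivAt (fun z : ℂ ↦ α * z + u₀) α (s : ℂ) := by
      simpa using ((hasDerivAt_id (s : ℂ)).const_mul α).add_const u₀
    have h2 := ((hasDerivAt_weierstrassZeta L (hu₀ s h).1).comp (s : ℂ) hlin).comp_ofReal
    have h3 : HasDerivAt (fun s : ℝ ↦ e₁ A * α * (s : ℂ)) (e₁ A * α) s := by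
      simpa using ((hasDerivAt_id (s : ℂ)).const_mul (e₁ A * α)).comp_ofReal
    refine (h1.sub ((h2.neg.sub h3).const_mul (Complex.I / α))).congr_deriv ?_
    rw [hZE s h, hEX s h]
    field_simp
    ring
  obtain ⟨m, hm⟩ := nonempty_Ioo.mpr hs
  refine ⟨θ, u₀, F m, fun s h ↦ ⟨(hu₀ s h).1, hZE s h, hEX s h, ?_⟩⟩
  have hFs : F s = F m := isOpen_Ioo.is_const_of_deriv_eq_zero isPreconnected_Ioo
    (fun t ht ↦ (hF t ht).differentiableAt.differentiableWithinAt)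
    (fun t ht ↦ (hF t ht).deriv) h hm
  rw [← hFs]
  simp only [F]
  ring

end Elastica

end

/-! ### Tools from the calculus of variations. -/

section

open Filter Topology Set MeasureTheory

/-- Differentiation under the integral sign, for an integrand that is jointly `C¹` at the points
of the segment of integration. -/
theorem hasDerivAt_intervalIntegral_of_contDiffAt {F : ℝ → ℝ → ℝ} {F' : ℝ → ℝ} {c d t₀ : ℝ}
    (hcd : c ≤ d) (hF : ∀ s ∈ Icc c d, ContDiffAt ℝ 1 (Function.uncurry F) (t₀, s))
    (hF' : ∀ s ∈ Icc c d, HasDerivAt (F · s) (F' s) t₀) :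
    HasDerivAt (fun t ↦ ∫ s in c..d, F t s) (∫ s in c..d, F' s) t₀ := by
  let U : Set (ℝ × ℝ) := {x | ContDiffAt ℝ 1 (Function.uncurry F) x}
  have hU : IsOpen U := isOpen_iff_mem_nhds.mpr fun x hx ↦
    ContDiffAt.eventually (h := hx) (h' := by decide)
  have hUd : ContDiffOn ℝ 1 (Function.uncurry F) U := fun x hx ↦ ContDiffAt.contDiffWithinAt hx
  have hcont : ContinuousOn (fun x ↦ fderiv ℝ (Function.uncurry F) x (1, 0)) U :=
    (hUd.continuousOn_fderiv_of_isOpen hU le_rfl).clm_apply continuousOn_const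
  -- By compactness of [c, d], the C¹ region contains a product of a closed ball about t₀ with [c,
  -- d]; there the t-derivative is bounded by a constant, which serves as the dominating function.
  obtain ⟨u, v, hu, -, hut, hv, huv⟩ := generalized_tube_lemma (isCompact_singleton (x := t₀))
    (isCompact_Icc (a := c) (b := d)) hU (by rintro ⟨t, s⟩ ⟨rfl, hs⟩; exact hF s hs)
  obtain ⟨δ, hδ, hball⟩ := Metric.nhds_basis_closedBall.mem_iff.mp
    (hu.mem_nhds (hut rfl))
  have hmem (t : ℝ) (ht : t ∈ Metric.closedBall t₀ δ) (s : ℝ) (hs : s ∈ Icc c d) : (t, s) ∈ U :=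
    huv ⟨hball ht, hv hs⟩
  obtain ⟨C, hC⟩ := ((isCompact_closedBall t₀ δ).prod (isCompact_Icc (a := c) (b := d)))
    |>.exists_bound_of_continuousOn (hcont.mono fun x hx ↦ hmem x.1 hx.1 x.2 hx.2)
  have hsub : uIoc c d ⊆ Icc c d := by
    rw [uIoc_of_le hcd]
    exact Ioc_subset_Icc_self
  have hmap (t : ℝ) (ht : t ∈ Metric.closedBall t₀ δ) :
      MapsTo (fun s : ℝ ↦ (t, s)) (Icc c d) U := fun s hs ↦ hmem t ht s hs
  have hFc (t : ℝ) (ht : t ∈ Metric.closedBall t₀ δ) : ContinuousOn (F t) (Icc c d) :=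
    hUd.continuousOn.comp (by fun_prop) (hmap t ht)
  have ht₀ := Metric.mem_closedBall_self (x := t₀) hδ.le
  have hd (t : ℝ) (ht : t ∈ Metric.closedBall t₀ δ) (s : ℝ) (hs : s ∈ Icc c d) :
      HasDerivAt (F · s) (fderiv ℝ (Function.uncurry F) (t, s) (1, 0)) t := by
    have h1 := (ContDiffAt.differentiableAt (n := 1) (f := Function.uncurry F)
      (show ContDiffAt ℝ 1 _ _ from hmem t ht s hs) one_ne_zero).hasFDerivAt
    have h2 : HasDerivAt (fun t : ℝ ↦ (t, s)) (1, 0) t :=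
      (hasDerivAt_id t).prodMk (hasDerivAt_const t s)
    exact h1.comp_hasDerivAt t h2
  have hae {f : ℝ → ℝ} (hf : ContinuousOn f (Icc c d)) :
      AEStronglyMeasurable f (volume.restrict (uIoc c d)) :=
    (hf.mono hsub).aestronglyMeasurable measurableSet_uIoc
  have key := (intervalIntegral.hasDerivAt_integral_of_dominated_loc_of_deriv_le (μ := volume)
    (F := F) (F' := fun t s ↦ fderiv ℝ (Function.uncurry F) (t, s) (1, 0)) (x₀ := t₀)
    (bound := fun _ ↦ C) (a := c) (b := d) (Metric.closedBall_mem_nhds t₀ hδ)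
    (by filter_upwards [Metric.closedBall_mem_nhds t₀ hδ] with t ht using hae (hFc t ht))
    ((hFc t₀ ht₀).intervalIntegrable_of_Icc hcd)
    (hae (hcont.comp (by fun_prop) (hmap t₀ ht₀)))
    (.of_forall fun s hs t ht ↦ hC (t, s) ⟨ht, hsub hs⟩) intervalIntegrable_const
    (.of_forall fun s hs t ht ↦ hd t ht s (hsub hs))).2
  refine key.congr_deriv (intervalIntegral.integral_congr fun s hs ↦ ?_)
  rw [uIcc_of_le hcd] at hs
  exact (hd t₀ ht₀ s hs).unique (hF' s hs)

/-- Lagrange multipliers for linear functionals on test functions: if `∫ ε g` vanishes whenever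
`∫ ε k` does, then `g` is a multiple of `k`. -/
theorem exists_eq_mul_of_integral_contDiff_smul {U : Set ℝ} (hU : IsOpen U) {k g : ℝ → ℝ}
    (hk : ContinuousOn k U) (hg : ContinuousOn g U)
    (h : ∀ ε : ℝ → ℝ, ContDiff ℝ ∞ ε → HasCompactSupport ε → tsupport ε ⊆ U →
      ∫ x, ε x • k x = 0 → ∫ x, ε x • g x = 0) :
    ∃ c : ℝ, ∀ x ∈ U, g x = c * k x := by
  have hint {f : ℝ → ℝ} (hf : ContinuousOn f U) {ε : ℝ → ℝ} (h1 : ContDiff ℝ ∞ ε)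
      (h2 : HasCompactSupport ε) (h3 : tsupport ε ⊆ U) : Integrable (fun x ↦ ε x • f x) := by
    have hc : ContinuousOn (fun x ↦ ε x • f x) (tsupport ε) :=
      h1.continuous.continuousOn.smul (hf.mono h3)
    refine (integrableOn_iff_integrable_of_support_subset ?_).mp (hc.integrableOn_compact h2)
    exact (Function.support_smul_subset_left ε f).trans (subset_tsupport ε)
  have hzero {f : ℝ → ℝ} (hf : ContinuousOn f U)
      (h0 : ∀ ε : ℝ → ℝ, ContDiff ℝ ∞ ε → HasCompactSupport ε → tsupport ε ⊆ U →
        ∫ x, ε x • f x = 0) : ∀ x ∈ U, f x = 0 := by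
    have hae := hU.ae_eq_zero_of_integral_contDiff_smul_eq_zero
      (hf.locallyIntegrableOn hU.measurableSet) h0
    exact Measure.eqOn_open_of_ae_eq ((ae_restrict_iff' hU.measurableSet).mpr hae) hU hf
      continuousOn_const
  -- If ∫ εk vanishes for every ε, the multiplier 0 works. Otherwise some η has ∫ ηk ≠ 0, and
  -- subtracting from ε a suitable multiple of η enforces the constraint.
  by_cases hall : ∀ ε : ℝ → ℝ, ContDiff ℝ ∞ ε → HasCompactSupport ε → tsupport ε ⊆ U →
      ∫ x, ε x • k x = 0
  · refine ⟨0, fun x hx ↦ ?_⟩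
    rw [zero_mul]
    exact hzero hg (fun ε h1 h2 h3 ↦ h ε h1 h2 h3 (hall ε h1 h2 h3)) x hx
  push Not at hall
  obtain ⟨η, hη1, hη2, hη3, hη⟩ := hall
  refine ⟨(∫ x, η x • g x) / ∫ x, η x • k x, fun x hx ↦ ?_⟩
  set c := (∫ x, η x • g x) / ∫ x, η x • k x with hc
  refine sub_eq_zero.mp (hzero (f := fun x ↦ g x - c * k x)
    (hg.sub (continuousOn_const.mul hk)) (fun ε h1 h2 h3 ↦ ?_) x hx)
  set m := (∫ x, ε x • k x) / ∫ x, η x • k x with hm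
  have hsplit {f : ℝ → ℝ} (hf : ContinuousOn f U) :
      ∫ x, (ε x - m * η x) • f x = (∫ x, ε x • f x) - m * ∫ x, η x • f x := by
    rw [← integral_const_mul, ← integral_sub (hint hf h1 h2 h3)
      ((hint hf hη1 hη2 hη3).const_mul m)]
    simp only [smul_eq_mul]
    congr with x
    ring
  have hsupp : tsupport (fun x ↦ ε x - m * η x) ⊆ tsupport ε ∪ tsupport η := by
    refine closure_minimal (fun x hx ↦ ?_) ((isClosed_tsupport _).union (isClosed_tsupport _))
    by_contra hcon
    rw [mem_union, not_or] at hcon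
    simp [image_eq_zero_of_notMem_tsupport hcon.1, image_eq_zero_of_notMem_tsupport hcon.2] at hx
  have := h (fun x ↦ ε x - m * η x) (h1.sub (contDiff_const.mul hη1))
    ((h2.isCompact.union hη2.isCompact).of_isClosed_subset (isClosed_tsupport _) hsupp)
    (hsupp.trans (union_subset h3 hη3)) (by rw [hsplit hk, hm]; field_simp; ring)
  rw [hsplit hg] at this
  have e : ∫ x, ε x • (g x - c * k x) = (∫ x, ε x • g x) - c * ∫ x, ε x • k x := by
    rw [← integral_const_mul, ← integral_sub (hint hg h1 h2 h3)
      ((hint hk h1 h2 h3).const_mul c)]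
    simp only [smul_eq_mul]
    congr with x
    ring
  rw [e, hc, ← this, hm]
  ring

/-! ### First variation of length and energy. -/

namespace Elastica

section Pointwise

variable {Z : ℝ → ℂ} {φ ε : ℝ → ℝ} {s₁ s₂ : ℝ}

theorem IsTangentialAngle.hasDerivAt_exp (hφ : IsTangentialAngle φ Z s₁ s₂) {s : ℝ}
    (hs : s ∈ Ioo s₁ s₂) :
    HasDerivAt (fun s ↦ Complex.exp (Complex.I * φ s))
      (Complex.exp (Complex.I * φ s) * (Complex.I * (deriv φ s : ℝ))) s := by
  have h1 : HasDerivAt φ (deriv φ s) s := (hφ.analytic s hs).differentiableAt.hasDerivAt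
  exact (h1.ofReal_comp.const_mul Complex.I).cexp

theorem IsTangentialAngle.hasDerivAt_normalDeformation (hφ : IsTangentialAngle φ Z s₁ s₂)
    (hZ : DifferentiableOn ℝ Z (Ioo s₁ s₂)) (hε : ContDiff ℝ ∞ ε) (t : ℝ) {s : ℝ}
    (hs : s ∈ Ioo s₁ s₂) :
    HasDerivAt (normalDeformation Z ε t) (Complex.exp (Complex.I * φ s) *
      (((1 - t * (ε s * deriv φ s) : ℝ) : ℂ) + ((t * deriv ε s : ℝ) : ℂ) * Complex.I)) s := by
  have h1 : HasDerivAt Z (Complex.exp (Complex.I * φ s)) s := by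
    rw [← hφ.tangent s hs]
    exact (hZ.differentiableAt (isOpen_Ioo.mem_nhds hs)).hasDerivAt
  have h2 : HasDerivAt ε (deriv ε s) s := (hε.differentiable (by simp) s).hasDerivAt
  have h3 : HasDerivAt (fun s ↦ Z s + t * ε s * (Complex.I * Complex.exp (Complex.I * φ s))) _ s :=
    h1.add ((h2.ofReal_comp.const_mul (t : ℂ)).mul ((hφ.hasDerivAt_exp hs).const_mul Complex.I))
  refine (h3.congr_of_eventuallyEq ?_).congr_deriv ?_
  · filter_upwards [isOpen_Ioo.mem_nhds hs] with x hx
    rw [normalDeformation, hφ.tangent x hx]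
  · push_cast
    linear_combination (t * ε s * Complex.exp (Complex.I * φ s) * ((deriv φ s : ℝ) : ℂ)) *
      Complex.I_sq

theorem IsTangentialAngle.hasDerivAt_deriv_normalDeformation (hφ : IsTangentialAngle φ Z s₁ s₂)
    (hZ : DifferentiableOn ℝ Z (Ioo s₁ s₂)) (hε : ContDiff ℝ ∞ ε) (t : ℝ) {s : ℝ}
    (hs : s ∈ Ioo s₁ s₂) :
    HasDerivAt (deriv (normalDeformation Z ε t)) (Complex.exp (Complex.I * φ s) *
      (((t * -(2 * deriv ε s * deriv φ s + ε s * deriv (deriv φ) s) : ℝ) : ℂ) +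
        ((deriv φ s + t * (deriv (deriv ε) s - ε s * deriv φ s ^ 2) : ℝ) : ℂ) * Complex.I)) s := by
  have h2 : HasDerivAt ε (deriv ε s) s := (hε.differentiable (by simp) s).hasDerivAt
  have h2' : HasDerivAt (deriv ε) (deriv (deriv ε) s) s := by
    have h : ContDiff ℝ ∞ (deriv ε) := (contDiff_infty_iff_deriv.mp hε).2
    exact (h.differentiable (by simp) s).hasDerivAt
  have hk : HasDerivAt (deriv φ) (deriv (deriv φ) s) s :=
    (hφ.analytic s hs).deriv.differentiableAt.hasDerivAt
  have h3 := (hφ.hasDerivAt_exp hs).mul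
    ((((h2.mul hk).const_mul t).const_sub 1).ofReal_comp.add
      ((h2'.const_mul t).ofReal_comp.mul_const Complex.I))
  refine (h3.congr_of_eventuallyEq ?_).congr_deriv ?_
  · filter_upwards [isOpen_Ioo.mem_nhds hs] with x hx
    rw [(hφ.hasDerivAt_normalDeformation hZ hε t hx).deriv]
    rfl
  · simp only [Pi.add_apply, Pi.mul_apply]
    push_cast
    linear_combination (t * ((deriv ε s : ℝ) : ℂ) * Complex.exp (Complex.I * φ s) *
      ((deriv φ s : ℝ) : ℂ)) * Complex.I_sq

theorem norm_exp_mul_add (x p q : ℝ) :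
    ‖Complex.exp (Complex.I * x) * ((p : ℂ) + (q : ℂ) * Complex.I)‖ = √(p ^ 2 + q ^ 2) := by
  rw [norm_mul, Complex.norm_exp_I_mul_ofReal, one_mul, Complex.norm_add_mul_I]

theorem im_conj_exp_mul (x p q r m : ℝ) :
    ((starRingEnd ℂ) (Complex.exp (Complex.I * x) * ((p : ℂ) + (q : ℂ) * Complex.I)) *
      (Complex.exp (Complex.I * x) * ((r : ℂ) + (m : ℂ) * Complex.I))).im = p * m - q * r := by
  have h : (starRingEnd ℂ) (Complex.exp (Complex.I * x)) * Complex.exp (Complex.I * x) = 1 := by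
    rw [Complex.conj_mul', Complex.norm_exp_I_mul_ofReal]
    simp
  have : (starRingEnd ℂ) (Complex.exp (Complex.I * x) * ((p : ℂ) + (q : ℂ) * Complex.I)) *
      (Complex.exp (Complex.I * x) * ((r : ℂ) + (m : ℂ) * Complex.I)) =
      ((p : ℂ) - (q : ℂ) * Complex.I) * ((r : ℂ) + (m : ℂ) * Complex.I) := by
    simp only [map_mul, map_add, Complex.conj_ofReal, Complex.conj_I]
    linear_combination (((p : ℂ) - (q : ℂ) * Complex.I) * ((r : ℂ) + (m : ℂ) * Complex.I)) * h
  rw [this]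
  simp
  ring

end Pointwise

section FirstVariation

/-- The speed `|1 - t u + i t v|`. -/
noncomputable def speedFamily (u v : ℝ → ℝ) (t s : ℝ) : ℝ := √((1 - t * u s) ^ 2 + (t * v s) ^ 2)

/-- The density of the bending energy of a curve with first derivative `1 - t u + i t v` and
second derivative `t w + i (k + t z)`, in a rotated frame. -/
noncomputable def energyFamily (k u v w z : ℝ → ℝ) (t s : ℝ) : ℝ :=
  (((1 - t * u s) * (k s + t * z s) - t * v s * (t * w s)) / speedFamily u v t s ^ 3) ^ 2 *
    speedFamily u v t s

variable {k u v w z : ℝ → ℝ} {s : ℝ}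

theorem speedFamily_zero : speedFamily u v 0 s = 1 := by simp [speedFamily]

theorem contDiffAt_speedFamily (hu : ContDiffAt ℝ 1 u s) (hv : ContDiffAt ℝ 1 v s) :
    ContDiffAt ℝ 1 (Function.uncurry (speedFamily u v)) (0, s) := by
  have hu' : ContDiffAt ℝ 1 (fun x : ℝ × ℝ ↦ u x.2) (0, s) :=
    ContDiffAt.comp (0, s) (g := u) (f := Prod.snd) hu contDiffAt_snd
  have hv' : ContDiffAt ℝ 1 (fun x : ℝ × ℝ ↦ v x.2) (0, s) :=
    ContDiffAt.comp (0, s) (g := v) (f := Prod.snd) hv contDiffAt_snd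
  refine ContDiffAt.sqrt (f := fun x : ℝ × ℝ ↦ (1 - x.1 * u x.2) ^ 2 + (x.1 * v x.2) ^ 2) ?_
    (by simp)
  exact ((contDiffAt_const.sub (contDiffAt_fst.mul hu')).pow 2).add
    ((contDiffAt_fst.mul hv').pow 2)

theorem contDiffAt_energyFamily (hk : ContDiffAt ℝ 1 k s) (hu : ContDiffAt ℝ 1 u s)
    (hv : ContDiffAt ℝ 1 v s) (hw : ContDiffAt ℝ 1 w s) (hz : ContDiffAt ℝ 1 z s) :
    ContDiffAt ℝ 1 (Function.uncurry (energyFamily k u v w z)) (0, s) := by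
  have hsnd {f : ℝ → ℝ} (hf : ContDiffAt ℝ 1 f s) :
      ContDiffAt ℝ 1 (fun x : ℝ × ℝ ↦ f x.2) (0, s) :=
    ContDiffAt.comp (0, s) (g := f) (f := Prod.snd) hf contDiffAt_snd
  have hsp := contDiffAt_speedFamily hu hv
  refine ContDiffAt.mul (ContDiffAt.pow (ContDiffAt.div ?_ (hsp.pow 3) ?_) 2) hsp
  · exact ((contDiffAt_const.sub (contDiffAt_fst.mul (hsnd hu))).mul
      ((hsnd hk).add (contDiffAt_fst.mul (hsnd hz)))).sub
      ((contDiffAt_fst.mul (hsnd hv)).mul (contDiffAt_fst.mul (hsnd hw)))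
  · simp [Function.uncurry, speedFamily_zero]

theorem hasDerivAt_speedFamily : HasDerivAt (speedFamily u v · s) (-u s) 0 := by
  have h1 := (((hasDerivAt_id (0 : ℝ)).mul_const (u s)).const_sub 1).pow 2
  have h2 := ((hasDerivAt_id (0 : ℝ)).mul_const (v s)).pow 2
  refine ((h1.add h2).sqrt (by simp)).congr_deriv ?_
  simp
  ring

/-- The density is N²/σ⁵, with N the numerator of the curvature and σ the speed. At t = 0, N' = z −
uk and σ' = −u; v and w enter only at order t². -/
theorem hasDerivAt_energyFamily :
    HasDerivAt (energyFamily k u v w z · s) (2 * k s * z s + 3 * k s ^ 2 * u s) 0 := by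
  have hsp := hasDerivAt_speedFamily (u := u) (v := v) (s := s)
  have hid (x : ℝ) : HasDerivAt (fun t : ℝ ↦ t * x) x 0 := by
    simpa using (hasDerivAt_id (0 : ℝ)).mul_const x
  have hnum := (((hid (u s)).const_sub 1).mul ((hid (z s)).const_add (k s))).sub
    ((hid (v s)).mul (hid (w s)))
  refine (((hnum.div (hsp.pow 3) (by simp [speedFamily_zero])).pow 2).mul hsp).congr_deriv ?_
  simp [speedFamily_zero]
  ring

end FirstVariation

/-! ### The Euler–Lagrange equation. -/

section EulerLagrange

variable {Z : ℝ → ℂ} {φ ε : ℝ → ℝ} {s₁ s₂ c d : ℝ}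

theorem IsTangentialAngle.arcLength_normalDeformation (hφ : IsTangentialAngle φ Z s₁ s₂)
    (hZ : DifferentiableOn ℝ Z (Ioo s₁ s₂)) (hε : ContDiff ℝ ∞ ε) (hc : s₁ < c) (hcd : c ≤ d)
    (hd : d < s₂) (t : ℝ) :
    arcLength (normalDeformation Z ε t) c d =
      ∫ s in c..d, speedFamily (fun s ↦ ε s * deriv φ s) (deriv ε) t s := by
  refine intervalIntegral.integral_congr fun s hs ↦ ?_
  rw [uIcc_of_le hcd] at hs
  simp only [(hφ.hasDerivAt_normalDeformation hZ hε t
    ⟨hc.trans_le hs.1, hs.2.trans_lt hd⟩).deriv, norm_exp_mul_add, speedFamily]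

theorem IsTangentialAngle.bendingEnergy_normalDeformation (hφ : IsTangentialAngle φ Z s₁ s₂)
    (hZ : DifferentiableOn ℝ Z (Ioo s₁ s₂)) (hε : ContDiff ℝ ∞ ε) (hc : s₁ < c) (hcd : c ≤ d)
    (hd : d < s₂) (t : ℝ) :
    bendingEnergy (normalDeformation Z ε t) c d =
      1 / 2 * ∫ s in c..d, energyFamily (deriv φ) (fun s ↦ ε s * deriv φ s) (deriv ε)
        (fun s ↦ -(2 * deriv ε s * deriv φ s + ε s * deriv (deriv φ) s))
        (fun s ↦ deriv (deriv ε) s - ε s * deriv φ s ^ 2) t s := by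
  rw [bendingEnergy]
  congr 1
  refine intervalIntegral.integral_congr fun s hs ↦ ?_
  rw [uIcc_of_le hcd] at hs
  have hs' : s ∈ Ioo s₁ s₂ := ⟨hc.trans_le hs.1, hs.2.trans_lt hd⟩
  simp only [curvature, (hφ.hasDerivAt_normalDeformation hZ hε t hs').deriv,
    (hφ.hasDerivAt_deriv_normalDeformation hZ hε t hs').deriv, norm_exp_mul_add, im_conj_exp_mul,
    energyFamily, speedFamily]

theorem IsTangentialAngle.hasDerivAt_arcLength (hφ : IsTangentialAngle φ Z s₁ s₂)
    (hZ : DifferentiableOn ℝ Z (Ioo s₁ s₂)) (hε : ContDiff ℝ ∞ ε) (hc : s₁ < c) (hcd : c ≤ d)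
    (hd : d < s₂) :
    HasDerivAt (fun t : ℝ ↦ arcLength (normalDeformation Z ε t) c d)
      (∫ s in c..d, -(ε s * deriv φ s)) 0 := by
  simp only [hφ.arcLength_normalDeformation hZ hε hc hcd hd]
  refine hasDerivAt_intervalIntegral_of_contDiffAt hcd (fun s hs ↦ ?_)
    fun s hs ↦ hasDerivAt_speedFamily
  have hs' : s ∈ Ioo s₁ s₂ := ⟨hc.trans_le hs.1, hs.2.trans_lt hd⟩
  have hk : ContDiffAt ℝ 1 (deriv φ) s := (hφ.analytic s hs').deriv.contDiffAt
  have hε' : ContDiff ℝ ∞ (deriv ε) := (contDiff_infty_iff_deriv.mp hε).2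
  exact contDiffAt_speedFamily ((hε.of_le (by simp)).contDiffAt.mul hk)
    (hε'.of_le (by simp)).contDiffAt

theorem IsTangentialAngle.hasDerivAt_bendingEnergy (hφ : IsTangentialAngle φ Z s₁ s₂)
    (hZ : DifferentiableOn ℝ Z (Ioo s₁ s₂)) (hε : ContDiff ℝ ∞ ε) (hc : s₁ < c) (hcd : c ≤ d)
    (hd : d < s₂) (hsupp : tsupport ε ⊆ Ioo c d) :
    HasDerivAt (fun t : ℝ ↦ bendingEnergy (normalDeformation Z ε t) c d)
      (∫ s in c..d, ε s * (deriv (deriv (deriv φ)) s + 1 / 2 * deriv φ s ^ 3)) 0 := by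
  simp only [hφ.bendingEnergy_normalDeformation hZ hε hc hcd hd]
  have hmem {s : ℝ} (hs : s ∈ Icc c d) : s ∈ Ioo s₁ s₂ :=
    ⟨hc.trans_le hs.1, hs.2.trans_lt hd⟩
  have hε' : ContDiff ℝ ∞ (deriv ε) := (contDiff_infty_iff_deriv.mp hε).2
  have hε'' : ContDiff ℝ ∞ (deriv (deriv ε)) := (contDiff_infty_iff_deriv.mp hε').2
  have e1 (s : ℝ) : ContDiffAt ℝ 1 ε s := (hε.of_le (by simp)).contDiffAt
  have e2 (s : ℝ) : ContDiffAt ℝ 1 (deriv ε) s := (hε'.of_le (by simp)).contDiffAt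
  have e3 (s : ℝ) : ContDiffAt ℝ 1 (deriv (deriv ε)) s := (hε''.of_le (by simp)).contDiffAt
  have k1 {s : ℝ} (hs : s ∈ Icc c d) : ContDiffAt ℝ 1 (deriv φ) s :=
    (hφ.analytic s (hmem hs)).deriv.contDiffAt
  have k2 {s : ℝ} (hs : s ∈ Icc c d) : ContDiffAt ℝ 1 (deriv (deriv φ)) s :=
    (hφ.analytic s (hmem hs)).deriv.deriv.contDiffAt
  have k3 {s : ℝ} (hs : s ∈ Icc c d) : ContDiffAt ℝ 1 (deriv (deriv (deriv φ))) s :=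
    (hφ.analytic s (hmem hs)).deriv.deriv.deriv.contDiffAt
  have hcont {f : ℝ → ℝ} (hf : ∀ s ∈ Icc c d, ContDiffAt ℝ 1 f s) :
      IntervalIntegrable f volume c d :=
    ContinuousOn.intervalIntegrable_of_Icc hcd
      fun s hs ↦ (hf s hs).continuousAt.continuousWithinAt
  have key := (hasDerivAt_intervalIntegral_of_contDiffAt hcd (fun s hs ↦
    contDiffAt_energyFamily (k1 hs) ((e1 s).mul (k1 hs)) (e2 s)
      (w := fun s ↦ -(2 * deriv ε s * deriv φ s + ε s * deriv (deriv φ) s))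
      (((contDiffAt_const.mul (e2 s)).mul (k1 hs)).add ((e1 s).mul (k2 hs))).neg
      (z := fun s ↦ deriv (deriv ε) s - ε s * deriv φ s ^ 2)
      ((e3 s).sub ((e1 s).mul ((k1 hs).pow 2))))
    fun s hs ↦ hasDerivAt_energyFamily).const_mul (1 / 2)
  refine key.congr_deriv ?_
  have hc0 : c ∉ tsupport ε := fun h ↦ lt_irrefl _ (hsupp h).1
  have hd0 : d ∉ tsupport ε := fun h ↦ lt_irrefl _ (hsupp h).2
  have hz {x : ℝ} (hx : x ∉ tsupport ε) : ε x = 0 ∧ deriv ε x = 0 :=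
    ⟨image_eq_zero_of_notMem_tsupport hx, image_eq_zero_of_notMem_tsupport
      fun h ↦ hx (tsupport_deriv_subset h)⟩
  -- With u = εk and z = ε'' − εk², half the derivative of the density is kε'' + εk³/2. Two
  -- integrations by parts turn kε'' into k''ε; the boundary terms vanish since c and d lie outside
  -- the support of ε.
  have hparts : ∫ s in c..d, (deriv φ s * deriv (deriv ε) s -
      deriv (deriv (deriv φ)) s * ε s) = 0 := by
    rw [intervalIntegral.integral_eq_sub_of_hasDerivAt
      (f := fun s ↦ deriv φ s * deriv ε s - deriv (deriv φ) s * ε s) (fun s hs ↦ ?_)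
      (hcont fun s hs ↦ ((k1 hs).mul (e3 s)).sub ((k3 hs).mul (e1 s)))]
    · simp [hz hc0, hz hd0]
    · rw [uIcc_of_le hcd] at hs
      have d1 {f : ℝ → ℝ} (h : ContDiffAt ℝ 1 f s) : HasDerivAt f (deriv f s) s :=
        (h.differentiableAt one_ne_zero).hasDerivAt
      exact (((d1 (k1 hs)).mul (d1 (e2 s))).sub ((d1 (k2 hs)).mul (d1 (e1 s)))).congr_deriv
        (by ring)
  rw [← intervalIntegral.integral_const_mul, ← sub_eq_zero, ← intervalIntegral.integral_sub,
    ← hparts]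
  · refine intervalIntegral.integral_congr fun s _ ↦ ?_
    ring
  · exact (hcont fun s hs ↦ contDiffAt_const.mul (((contDiffAt_const.mul (k1 hs)).mul
      ((e3 s).sub ((e1 s).mul ((k1 hs).pow 2)))).add
      ((contDiffAt_const.mul ((k1 hs).pow 2)).mul ((e1 s).mul (k1 hs)))))
  · exact hcont fun s hs ↦ (e1 s).mul ((k3 hs).add (contDiffAt_const.mul ((k1 hs).pow 3)))

/-- The Euler-Lagrange equation of an elastica and its first integral. -/
theorem IsElastica.exists_areConstants (hs : s₁ < s₂) (hZ : IsElastica Z s₁ s₂)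
    (hφ : IsTangentialAngle φ Z s₁ s₂) : ∃ a b : ℝ, AreConstants (deriv φ) s₁ s₂ a b := by
  have hZd : DifferentiableOn ℝ Z (Ioo s₁ s₂) := hZ.immersion.analytic.differentiableOn
  have k1 {s : ℝ} (h : s ∈ Ioo s₁ s₂) : DifferentiableAt ℝ (deriv φ) s :=
    (hφ.analytic s h).deriv.differentiableAt
  have k2 {s : ℝ} (h : s ∈ Ioo s₁ s₂) : DifferentiableAt ℝ (deriv (deriv φ)) s :=
    (hφ.analytic s h).deriv.deriv.differentiableAt
  have k3 {s : ℝ} (h : s ∈ Ioo s₁ s₂) : DifferentiableAt ℝ (deriv (deriv (deriv φ))) s :=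
    (hφ.analytic s h).deriv.deriv.deriv.differentiableAt
  -- The condition ∫ εk = 0 is exactly first-order preservation of length, so stationarity applies;
  -- the multiplier is l = −a.
  obtain ⟨l, hl⟩ := exists_eq_mul_of_integral_contDiff_smul isOpen_Ioo (k := deriv φ)
    (g := fun s ↦ deriv (deriv (deriv φ)) s + 1 / 2 * deriv φ s ^ 3)
    (fun s h ↦ (k1 h).continuousAt.continuousWithinAt)
    (fun s h ↦ ((k3 h).add (((k1 h).pow 3).const_mul (1 / 2))).continuousAt.continuousWithinAt)
    fun ε hε hcpt hsupp h0 ↦ by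
      obtain ⟨c, d, hc, hcd, hd, hsub⟩ :
          ∃ c d, s₁ < c ∧ c < d ∧ d < s₂ ∧ tsupport ε ⊆ Ioo c d := by
        rcases (tsupport ε).eq_empty_or_nonempty with he | hne
        · obtain ⟨c, h1, h2⟩ := exists_between hs
          obtain ⟨d, h3, h4⟩ := exists_between h2
          exact ⟨c, d, h1, h3, h4, by simp [he]⟩
        · obtain ⟨x, hx, hx'⟩ := hcpt.isCompact.exists_isLeast hne
          obtain ⟨y, hy, hy'⟩ := hcpt.isCompact.exists_isGreatest hne
          obtain ⟨c, h1, h2⟩ := exists_between (hsupp hx).1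
          obtain ⟨d, h3, h4⟩ := exists_between (hsupp hy).2
          exact ⟨c, d, h1, h2.trans_le ((hx' hy).trans h3.le), h4,
            fun z hz ↦ ⟨h2.trans_le (hx' hz), (hy' hz).trans_lt h3⟩⟩
      have hfull (f : ℝ → ℝ) : ∫ s in c..d, ε s * f s = ∫ s, ε s * f s :=
        intervalIntegral.integral_eq_integral_of_support_subset <|
          (Function.support_mul_subset_left ε f).trans <|
            (subset_tsupport ε).trans <| hsub.trans Ioo_subset_Ioc_self
      simp only [smul_eq_mul] at h0 ⊢
      have hlen := hφ.hasDerivAt_arcLength hZd hε hc hcd.le hd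
      rw [intervalIntegral.integral_neg, hfull, h0, neg_zero] at hlen
      have hen := hφ.hasDerivAt_bendingEnergy hZd hε hc hcd.le hd hsub
      rw [hfull] at hen
      exact hen.unique (hZ.stationary c d ε hc hcd hd hε hsub hlen)
  have hsec (s : ℝ) (h : s ∈ Ioo s₁ s₂) :
      -l * deriv φ s + 1 / 2 * deriv φ s ^ 3 + deriv (deriv (deriv φ)) s = 0 := by
    linear_combination hl s h
  -- The derivative of `I` is 2k' times the left side of the second-order equation; its constant
  -- value is −b.
  let I : ℝ → ℝ := fun s ↦
    deriv (deriv φ) s ^ 2 + 1 / 4 * deriv φ s ^ 4 + -l * deriv φ s ^ 2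
  have hI (s : ℝ) (h : s ∈ Ioo s₁ s₂) : HasDerivAt I 0 s := by
    refine (((k2 h).hasDerivAt.pow 2).add (((k1 h).hasDerivAt.pow 4).const_mul (1 / 4))).add
      (((k1 h).hasDerivAt.pow 2).const_mul (-l)) |>.congr_deriv ?_
    push_cast
    linear_combination 2 * deriv (deriv φ) s * hsec s h
  obtain ⟨m, hm⟩ := nonempty_Ioo.mpr hs
  refine ⟨-l, -I m, ⟨hsec, fun s h ↦ ?_⟩⟩
  have : I s = I m := isOpen_Ioo.is_const_of_deriv_eq_zero isPreconnected_Ioo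
    (fun t ht ↦ (hI t ht).differentiableAt.differentiableWithinAt)
    (fun t ht ↦ (hI t ht).deriv) h hm
  rw [← this]
  simp only [I]
  ring

end EulerLagrange

end Elastica

end

theorem mainTheorem2 (s₁ s₂ : ℝ) (hs : s₁ < s₂) (Z : ℝ → ℂ) (φ : ℝ → ℝ)
    (hZ : Elastica.IsElastica Z s₁ s₂) (hφ : Elastica.IsTangentialAngle φ Z s₁ s₂) :
    (∃ a b : ℝ, Elastica.AreConstants (deriv φ) s₁ s₂ a b) ∧
    ∀ a b : ℝ, Elastica.AreConstants (deriv φ) s₁ s₂ a b → a ^ 2 ≠ b → b ≠ 0 →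
      ∀ α : ℂ, α ^ 4 = ((a : ℂ) ^ 2 - (b : ℂ)) / 16 →
        (∃ L : PeriodPair, Elastica.IsPeriodPairOfC₁ L (-a / α ^ 2) (b / α ^ 4)) ∧
        ∀ L : PeriodPair, Elastica.IsPeriodPairOfC₁ L (-a / α ^ 2) (b / α ^ 4) →
          ∃ (θ : ℝ) (u₀ Z₀ : ℂ), ∀ s ∈ Set.Ioo s₁ s₂,
            α * s + u₀ ∉ L.lattice ∧
            Complex.exp (Complex.I * θ) * deriv Z s =
              Complex.exp (Complex.I * (φ s + θ)) ∧
            Complex.exp (Complex.I * (φ s + θ)) =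
              Complex.I * (L.weierstrassP (α * s + u₀) - Elastica.e₁ (-a / α ^ 2)) ∧
            Complex.exp (Complex.I * θ) * Z s =
              Complex.I / α * (-Elastica.weierstrassZeta L (α * s + u₀)
                - Elastica.e₁ (-a / α ^ 2) * α * s) + Z₀ := by
  have hZd : DifferentiableOn ℝ Z (Set.Ioo s₁ s₂) := hZ.immersion.analytic.differentiableOn
  refine ⟨hZ.exists_areConstants hs hφ, fun a b hab hne hb α hα ↦ ⟨?_, fun L hL ↦
    hab.exists_weierstrass hs hZd hφ hne hα hL⟩⟩
  have hα0 : α ≠ 0 := by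
    rintro rfl
    have : (a : ℂ) ^ 2 - b = 0 := by linear_combination -16 * hα
    exact hne (by exact_mod_cast sub_eq_zero.mp this)
  refine Elastica.exists_isPeriodPairOfC₁
    (div_ne_zero (Complex.ofReal_ne_zero.mpr hb) (pow_ne_zero 4 hα0)) fun h ↦ hne ?_
  field_simp at h
  have h' : (a : ℂ) ^ 2 = b := by linear_combination h
  exact_mod_cast h'
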